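/- For each integer $N\ge 1$ let $P_N(Z)=\sum_{k=0}^{N}a_{N,k}Z^k$ be a polynomial with complex coefficients such that $a_{N,0}\,a_{N,N}\neq 0$, and let $$L_N(P_N)=\log\Big(\sum_{k=0}^{N}|a_{N,k}|\Big)-\tfrac12\log|a_{N,0}|-\tfrac12\log|a_{N,N}|.$$ Let $z_1,\dots,z_N$ be the zeros of $P_N$, listed with multiplicity, and let $\arg z\in[0,2\pi)$ denote the argument of $z\neq 0$. For $0<\rho<1$ and $0\le\theta<\phi\le 2\pi$ put $$\nu_N(\rho)=\#\Big\{k: 1-\rho\le|z_k|\le\frac1{1-\rho}\Big\},\qquad \nu_N(\theta,\phi)=\#\{k:\theta\le\arg z_k<\phi\}.$$ If $L_N(P_N)=o(N)$ as $N\to\infty$, then the zeros cluster uniformly near the unit circle: for all $0<\rho<1$, $$\lim_{N\to\infty}\frac1N\,\nu_N(\rho)=1,$$ and for all $0\le\theta<\phi\le2\pi$, $$\lim_{N\to\infty}\frac1N\,\nu_N(\theta,\phi)=\frac{\phi-\theta}{2\pi}.$$ -/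

import Mathlib

open Filter Asymptotics

/-- The polynomial `∑_{k=0}^N a_k Z^k`. -/
noncomputable def coeffPoly (N : ℕ) (a : ℕ → ℂ) : Polynomial ℂ :=
  ∑ k ∈ Finset.range (N + 1), Polynomial.C (a k) * Polynomial.X ^ k

/-- `L_N = log (∑_{k=0}^N |a_k|) - (1/2) log |a_0| - (1/2) log |a_N|`. -/
noncomputable def coeffSize (N : ℕ) (a : ℕ → ℂ) : ℝ :=
  Real.log (∑ k ∈ Finset.range (N + 1), ‖a k‖)
    - (1 / 2) * Real.log ‖a 0‖ - (1 / 2) * Real.log ‖a N‖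

/-- The argument of a nonzero complex number, normalised to lie in `[0, 2π)`
(Mathlib's `Complex.arg` lies in `(-π, π]`). -/
noncomputable def argTwoPi (z : ℂ) : ℝ :=
  toIcoMod Real.two_pi_pos 0 z.arg

open Classical in
/-- The number of zeros of `P`, with multiplicity, in the closed annulus
`1 - ρ ≤ |z| ≤ 1 / (1 - ρ)`. -/
noncomputable def annulusCount (P : Polynomial ℂ) (ρ : ℝ) : ℕ :=
  P.roots.countP (fun z => 1 - ρ ≤ ‖z‖ ∧ ‖z‖ ≤ 1 / (1 - ρ))

open Classical in
/-- The number of zeros of `P`, with multiplicity, with argument in `[θ, φ)`. -/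
noncomputable def sectorCount (P : Polynomial ℂ) (θ φ : ℝ) : ℕ :=
  P.roots.countP (fun z => θ ≤ argTwoPi z ∧ argTwoPi z < φ)

/-!
Write `L` for `coeffSize N a` and `z i` for the zeros of `P = coeffPoly N a`.

*Moduli.* Jensen's formula identifies `log ‖a N‖ + ∑ log⁺ ‖z i‖` with the logarithmic Mahler measure
of `P`, which is at most `log ∑ ‖a k‖`. Together with `∏ ‖z i‖ = ‖a 0‖ / ‖a N‖` this gives
`∑ |log ‖z i‖| ≤ 2 L` (`sum_abs_log_norm_le`). A zero outside the annulus contributes at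
least `-log (1 - ρ)`, so only `O(L) = o(N)` zeros lie outside it.

*Arguments.* Let `u i = z i / ‖z i‖`. On the unit circle `‖1 - x conj (u i)‖ ^ 2` is at most
`‖x - z i‖ ^ 2 / ‖z i‖`, hence `‖∏ (1 - x conj (u i))‖ ≤ exp L` there
(`norm_prod_one_sub_le_exp_coeffSize`). The holomorphic function `∑ log (1 - x conj (u i))` on the
disc therefore has real part at most `L`, and the Borel–Carathéodory theorem and Cauchy's estimates
bound its Taylor coefficients: `‖∑ (u i) ^ m‖ ≤ m 2 ^ (m + 1) L = o(N)` for each fixed `m ≥ 1`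
(`norm_sum_pow_le_of_norm_prod_le`). Weyl's criterion
(`tendsto_card_arc_of_tendsto_sum_fourier`) turns this into equidistribution of the arguments. It
is obtained from the density of trigonometric polynomials and the portmanteau theorem on the circle.
-/

/-! ### Weyl's criterion on the circle -/

open MeasureTheory AddCircle in
/-- Weyl's criterion for measures: probability measures on the circle whose nonzero Fourier
coefficients tend to `0` converge weakly to Haar measure, since trigonometric polynomials
separate points and the circle is compact. -/
theorem tendsto_haarAddCircle_of_tendsto_integral_fourier {T : ℝ} [Fact (0 < T)] {ι : Type*}
    {l : Filter ι} {μ : ι → ProbabilityMeasure (AddCircle T)}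
    (h : ∀ n : ℤ, n ≠ 0 →
      Tendsto (fun i => ∫ x, fourier n x ∂(μ i : Measure (AddCircle T))) l (nhds 0)) :
    Tendsto μ l (nhds ⟨haarAddCircle, inferInstance⟩) := by
  have key : ∀ f ∈ Submodule.span ℂ (Set.range (@fourier T)),
      Tendsto (fun i => ∫ x, f x ∂(μ i : Measure (AddCircle T))) l
        (nhds (∫ x, f x ∂haarAddCircle)) := by
    have hint : ∀ (ν : Measure (AddCircle T)) [IsProbabilityMeasure ν] (f : C(AddCircle T, ℂ)),
        Integrable f ν := fun ν _ f =>
      (BoundedContinuousFunction.mkOfCompact f).integrable ν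
    intro f hf
    induction hf using Submodule.span_induction with
    | mem f hf =>
      obtain ⟨n, rfl⟩ := hf
      rcases eq_or_ne n 0 with rfl | hn
      · simpa using tendsto_const_nhds
      · rw [integral_eq_zero_of_add_right_eq_neg
          (fourier_add_half_inv_index hn (Fact.out : 0 < T))]
        exact h n hn
    | zero => simpa using tendsto_const_nhds
    | add f g _ _ hf hg =>
      simp only [ContinuousMap.add_apply]
      rw [integral_add (hint _ f) (hint _ g)]
      exact (hf.add hg).congr fun i => (integral_add (hint _ f) (hint _ g)).symm
    | smul c f _ hf =>
      simp only [ContinuousMap.smul_apply, integral_smul]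
      exact hf.const_smul c
  refine ProbabilityMeasure.tendsto_of_tight_of_separatesPoints ℂ .of_compactSpace
    (A := (@fourierSubalgebra T).comap (BoundedContinuousFunction.toContinuousMapStarₐ ℂ)) ?_ ?_
  · intro x y hxy
    obtain ⟨-, ⟨f, hf, rfl⟩, hne⟩ := fourierSubalgebra_separatesPoints (T := T) hxy
    exact ⟨f, ⟨f, ⟨BoundedContinuousFunction.mkOfCompact f, hf, rfl⟩, rfl⟩, hne⟩
  · intro g hg
    refine key (BoundedContinuousFunction.toContinuousMapStarₐ ℂ g) ?_
    rw [← fourierSubalgebra_coe]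
    exact hg

theorem AddCircle.volume_singleton {T : ℝ} [Fact (0 < T)] (x : AddCircle T) :
    MeasureTheory.volume ({x} : Set (AddCircle T)) = 0 := by
  rw [← Metric.closedBall_zero, AddCircle.volume_closedBall]
  simp [(Fact.out : 0 < T).le]

theorem AddCircle.image_coe_Ico {T θ φ : ℝ} (h : θ < φ) :
    ((↑) : ℝ → AddCircle T) '' Set.Ico θ φ
      = insert (θ : AddCircle T) ((↑) '' Set.Ioo θ φ) := by
  rw [← Set.Ioo_insert_left h, Set.image_insert_eq]

theorem AddCircle.isOpen_image_coe_Ioo {T : ℝ} (θ φ : ℝ) :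
    IsOpen (((↑) : ℝ → AddCircle T) '' Set.Ioo θ φ) :=
  QuotientAddGroup.isOpenMap_coe _ isOpen_Ioo

theorem AddCircle.volume_image_coe_Ico {T : ℝ} [Fact (0 < T)] {θ φ : ℝ} (h : θ < φ)
    (hφ : φ ≤ θ + T) :
    MeasureTheory.volume (((↑) : ℝ → AddCircle T) '' Set.Ico θ φ) = ENNReal.ofReal (φ - θ) := by
  have hpre : QuotientAddGroup.mk ⁻¹' (((↑) : ℝ → AddCircle T) '' Set.Ioo θ φ)
      ∩ Set.Ioc θ (θ + T) = Set.Ioo θ φ := by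
    ext x
    constructor
    · rintro ⟨⟨y, hy, hyx⟩, hx⟩
      rwa [← (AddCircle.coe_eq_coe_iff_of_mem_Ioc (p := T) (a := θ)
        ⟨hy.1, hy.2.le.trans hφ⟩ hx).1 hyx]
    · exact fun hx => ⟨⟨x, hx, rfl⟩, hx.1, hx.2.le.trans hφ⟩
  have : MeasureTheory.NullSingletonClass
      (MeasureTheory.volume : MeasureTheory.Measure (AddCircle T)) :=
    ⟨AddCircle.volume_singleton⟩
  rw [AddCircle.image_coe_Ico h,
    MeasureTheory.measure_congr (MeasureTheory.insert_ae_eq_self _ _),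
    AddCircle.add_projection_respects_measure T θ
      (AddCircle.isOpen_image_coe_Ioo θ φ).measurableSet,
    hpre, Real.volume_Ioo]

theorem AddCircle.volume_frontier_image_coe_Ico {T : ℝ} [Fact (0 < T)] {θ φ : ℝ} (h : θ < φ) :
    MeasureTheory.volume (frontier (((↑) : ℝ → AddCircle T) '' Set.Ico θ φ)) = 0 := by
  have hsub : frontier (((↑) : ℝ → AddCircle T) '' Set.Ico θ φ)
      ⊆ {(θ : AddCircle T)} ∪ {(φ : AddCircle T)} := by
    rintro x ⟨hx, hx'⟩
    have hcl : closure (((↑) : ℝ → AddCircle T) '' Set.Ico θ φ) ⊆ (↑) '' Set.Icc θ φ :=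
      closure_minimal (Set.image_mono Set.Ico_subset_Icc_self)
        (isCompact_Icc.image (AddCircle.continuous_mk' T)).isClosed
    have hin : (((↑) : ℝ → AddCircle T) '' Set.Ioo θ φ)
        ⊆ interior (((↑) : ℝ → AddCircle T) '' Set.Ico θ φ) :=
      interior_maximal (Set.image_mono Set.Ioo_subset_Ico_self)
        (AddCircle.isOpen_image_coe_Ioo θ φ)
    obtain ⟨y, hy, rfl⟩ := hcl hx
    rcases hy.1.eq_or_lt with rfl | h1
    · exact .inl rfl
    rcases hy.2.eq_or_lt with rfl | h2
    · exact .inr rfl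
    exact absurd (hin ⟨y, ⟨h1, h2⟩, rfl⟩) hx'
  exact MeasureTheory.measure_mono_null hsub
    (MeasureTheory.measure_union_null (AddCircle.volume_singleton _) (AddCircle.volume_singleton _))

/-- **Weyl's criterion** for a triangular array of points on the circle: if every nonzero
Fourier coefficient of the empirical measures tends to `0`, the proportion of points in a
half-open arc tends to its normalised length. -/
theorem tendsto_card_arc_of_tendsto_sum_fourier {T : ℝ} [hT : Fact (0 < T)]
    (x : ∀ N : ℕ, Fin (N + 1) → AddCircle T)
    (h : ∀ n : ℤ, n ≠ 0 →
      Tendsto (fun N : ℕ => (1 / ((N + 1 : ℕ) : ℂ)) * ∑ i, fourier n (x N i)) atTop (nhds 0))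
    {θ φ : ℝ} (hθφ : θ < φ) (hφ : φ ≤ θ + T) :
    Tendsto (fun N : ℕ => (1 / ((N + 1 : ℕ) : ℝ)) *
        (Nat.card {i // x N i ∈ ((↑) : ℝ → AddCircle T) '' Set.Ico θ φ} : ℝ))
      atTop (nhds ((φ - θ) / T)) := by
  classical
  set E : Set (AddCircle T) := ((↑) : ℝ → AddCircle T) '' Set.Ico θ φ with hE
  let p : ∀ N : ℕ, PMF (Fin (N + 1)) := fun N => PMF.uniformOfFintype _
  have hx : ∀ N, Measurable (x N) := fun N => measurable_of_finite _
  -- The empirical measure of the `N`-th row.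
  let μ : ℕ → MeasureTheory.ProbabilityMeasure (AddCircle T) := fun N =>
    ⟨(p N).toMeasure.map (x N), MeasureTheory.Measure.isProbabilityMeasure_map (hx N).aemeasurable⟩
  have hμ : Tendsto μ atTop (nhds ⟨AddCircle.haarAddCircle, inferInstance⟩) := by
    refine tendsto_haarAddCircle_of_tendsto_integral_fourier fun n hn => (h n hn).congr fun N => ?_
    change _ = ∫ y, fourier n y ∂((p N).toMeasure.map (x N))
    rw [MeasureTheory.integral_map (hx N).aemeasurable
      (fourier n).continuous.aestronglyMeasurable, PMF.integral_eq_sum, Finset.mul_sum]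
    refine Finset.sum_congr rfl fun i _ => ?_
    rw [PMF.uniformOfFintype_apply, Fintype.card_fin, ENNReal.toReal_inv, ENNReal.toReal_natCast,
      Complex.real_smul]
    simp only [one_div, Complex.ofReal_inv, Complex.ofReal_natCast]
  have hvol : (MeasureTheory.volume : MeasureTheory.Measure (AddCircle T))
      = ENNReal.ofReal T • AddCircle.haarAddCircle := AddCircle.volume_eq_smul_haarAddCircle
  have hfr : AddCircle.haarAddCircle (frontier E) = 0 := by
    have := AddCircle.volume_frontier_image_coe_Ico (T := T) hθφ
    rw [hvol] at this
    simpa [hT.out.not_ge] using this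
  have hEm : MeasurableSet E := by
    rw [hE, AddCircle.image_coe_Ico hθφ]
    exact (AddCircle.isOpen_image_coe_Ioo θ φ).measurableSet.insert _
  have hval : (AddCircle.haarAddCircle E).toReal = (φ - θ) / T := by
    have := AddCircle.volume_image_coe_Ico (T := T) hθφ hφ
    rw [hvol] at this
    have h2 := congrArg ENNReal.toReal this
    rw [MeasureTheory.Measure.smul_apply, smul_eq_mul, ENNReal.toReal_mul,
      ENNReal.toReal_ofReal hT.out.le, ENNReal.toReal_ofReal (by linarith)] at h2
    rw [eq_div_iff hT.out.ne', mul_comm]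
    exact h2
  have hlim := MeasureTheory.ProbabilityMeasure.tendsto_measure_of_null_frontier_of_tendsto' hμ hfr
  have hlim' := (ENNReal.tendsto_toReal (MeasureTheory.measure_ne_top AddCircle.haarAddCircle E)).comp hlim
  change Tendsto _ _ (nhds (AddCircle.haarAddCircle E).toReal) at hlim'
  rw [hval] at hlim'
  refine hlim'.congr fun N => ?_
  change (((p N).toMeasure.map (x N)) E).toReal = _
  rw [MeasureTheory.Measure.map_apply (hx N) hEm,
    PMF.toMeasure_uniformOfFintype_apply _ ((hx N) hEm), ENNReal.toReal_div]
  rw [Nat.card_eq_fintype_card, Fintype.card_fin, ENNReal.toReal_natCast, ENNReal.toReal_natCast,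
    one_div_mul_eq_div]
  congr 2

/-! ### The polynomial and its zeros -/

theorem coeffPoly_coeff (N : ℕ) (a : ℕ → ℂ) (k : ℕ) :
    (coeffPoly N a).coeff k = if k ≤ N then a k else 0 := by
  simp [coeffPoly, Polynomial.coeff_C_mul, Polynomial.coeff_X_pow]

theorem coeffPoly_natDegree {N : ℕ} {a : ℕ → ℂ} (h : a N ≠ 0) : (coeffPoly N a).natDegree = N := by
  refine le_antisymm ?_ (Polynomial.le_natDegree_of_ne_zero (by simpa [coeffPoly_coeff] using h))
  refine Polynomial.natDegree_le_iff_coeff_eq_zero.2 fun k hk => ?_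
  simp [coeffPoly_coeff, hk.not_ge]

theorem coeffPoly_leadingCoeff {N : ℕ} {a : ℕ → ℂ} (h : a N ≠ 0) :
    (coeffPoly N a).leadingCoeff = a N := by
  rw [Polynomial.leadingCoeff, coeffPoly_natDegree h, coeffPoly_coeff, if_pos le_rfl]

theorem coeffPoly_eval (N : ℕ) (a : ℕ → ℂ) (x : ℂ) :
    (coeffPoly N a).eval x = ∑ k ∈ Finset.range (N + 1), a k * x ^ k := by
  simp [coeffPoly, Polynomial.eval_finsetSum]

theorem Multiset.exists_fin_enumeration {α : Type*} (s : Multiset α) {N : ℕ} (h : s.card = N) :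
    ∃ z : Fin N → α, s = (Finset.univ : Finset (Fin N)).val.map z := by
  subst h
  induction s using Quotient.inductionOn with
  | h l =>
    refine ⟨l.get, ?_⟩
    exact ((Fin.univ_val_map l.get).trans (congrArg _ (List.ofFn_get l))).symm

/-- The zeros of `coeffPoly N a`, listed with multiplicity, and the factorisation over them. -/
theorem exists_zeros_coeffPoly {N : ℕ} {a : ℕ → ℂ} (h : a N ≠ 0) :
    ∃ z : Fin N → ℂ, (coeffPoly N a).roots = (Finset.univ : Finset (Fin N)).val.map z ∧
      ∀ x, (coeffPoly N a).eval x = a N * ∏ i, (x - z i) := by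
  have hs := IsAlgClosed.splits (coeffPoly N a)
  obtain ⟨z, hz⟩ := (coeffPoly N a).roots.exists_fin_enumeration (N := N)
    (by rw [← hs.natDegree_eq_card_roots, coeffPoly_natDegree h])
  refine ⟨z, hz, fun x => ?_⟩
  rw [hs.eval_eq_prod_roots, coeffPoly_leadingCoeff h, hz, Multiset.map_map]
  rfl

theorem Multiset.countP_map_univ {α ι : Type*} [Fintype ι] (z : ι → α) (p : α → Prop)
    [DecidablePred p] :
    ((Finset.univ : Finset ι).val.map z).countP p = Nat.card {i // p (z i)} := by
  rw [Multiset.countP_map, Nat.card_eq_fintype_card, Fintype.card_subtype]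
  rfl

/-! ### Moduli of the zeros -/

/-- Each of `‖a 0‖`, `‖a N‖` is strictly smaller than the coefficient sum, because both are
terms of it. -/
theorem coeffSize_pos {N : ℕ} (hN : 1 ≤ N) {a : ℕ → ℂ} (h0 : a 0 ≠ 0) (h1 : a N ≠ 0) :
    0 < coeffSize N a := by
  have hx := norm_pos_iff.2 h0
  have hy := norm_pos_iff.2 h1
  have hle : ‖a 0‖ + ‖a N‖ ≤ ∑ k ∈ Finset.range (N + 1), ‖a k‖ := by
    rw [Finset.sum_range_succ, Finset.sum_range_eq_add_Ico _ hN]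
    have : 0 ≤ ∑ k ∈ Finset.Ico 1 N, ‖a k‖ := Finset.sum_nonneg fun _ _ => norm_nonneg _
    linarith
  have hl1 := Real.log_lt_log hx (by linarith : ‖a 0‖ < ∑ k ∈ Finset.range (N + 1), ‖a k‖)
  have hl2 := Real.log_lt_log hy (by linarith : ‖a N‖ < ∑ k ∈ Finset.range (N + 1), ‖a k‖)
  unfold coeffSize
  linarith

theorem coeff_zero_eq_mul_prod_neg {N : ℕ} {a : ℕ → ℂ} {z : Fin N → ℂ}
    (hev : ∀ x, (coeffPoly N a).eval x = a N * ∏ i, (x - z i)) :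
    a 0 = a N * ∏ i, -z i := by
  have h := hev 0
  rw [← Polynomial.coeff_zero_eq_eval_zero, coeffPoly_coeff, if_pos N.zero_le] at h
  simpa only [zero_sub] using h

theorem zeros_ne_zero {N : ℕ} {a : ℕ → ℂ} (h0 : a 0 ≠ 0) {z : Fin N → ℂ}
    (hev : ∀ x, (coeffPoly N a).eval x = a N * ∏ i, (x - z i)) (i : Fin N) : z i ≠ 0 := by
  intro hi
  refine h0 ?_
  rw [coeff_zero_eq_mul_prod_neg hev, Finset.prod_eq_zero (Finset.mem_univ i) (by simp [hi]),
    mul_zero]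

theorem log_norm_coeff_zero {N : ℕ} {a : ℕ → ℂ} (h0 : a 0 ≠ 0) (h1 : a N ≠ 0) {z : Fin N → ℂ}
    (hev : ∀ x, (coeffPoly N a).eval x = a N * ∏ i, (x - z i)) :
    Real.log ‖a 0‖ = Real.log ‖a N‖ + ∑ i, Real.log ‖z i‖ := by
  have hne : ∀ i, ‖-z i‖ ≠ 0 := fun i => by simpa using zeros_ne_zero h0 hev i
  rw [coeff_zero_eq_mul_prod_neg hev, norm_mul, norm_prod,
    Real.log_mul (norm_ne_zero_iff.2 h1) (Finset.prod_ne_zero_iff.2 fun i _ => hne i),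
    Real.log_prod fun i _ => hne i]
  simp only [norm_neg]

/-- By Jensen's formula `log ‖a N‖ + ∑ log⁺ ‖z i‖` is the logarithmic Mahler measure, which is at
most the logarithm of the coefficient sum. The sum of the negative parts of `log ‖z i‖` then
follows from `∏ ‖z i‖ = ‖a 0‖ / ‖a N‖`. -/
theorem sum_abs_log_norm_le {N : ℕ} {a : ℕ → ℂ} (h0 : a 0 ≠ 0) (h1 : a N ≠ 0) {z : Fin N → ℂ}
    (hz : (coeffPoly N a).roots = (Finset.univ : Finset (Fin N)).val.map z)
    (hev : ∀ x, (coeffPoly N a).eval x = a N * ∏ i, (x - z i)) :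
    ∑ i, |Real.log ‖z i‖| ≤ 2 * coeffSize N a := by
  have hlog := log_norm_coeff_zero h0 h1 hev
  have hp : coeffPoly N a ≠ 0 := fun h => h1 (by
    rw [← coeffPoly_leadingCoeff h1, h, Polynomial.leadingCoeff_zero])
  have hM : Real.log ‖a N‖ + ∑ i, Real.posLog ‖z i‖
      ≤ Real.log (∑ k ∈ Finset.range (N + 1), ‖a k‖) := by
    have h2 := (coeffPoly N a).logMahlerMeasure_eq_log_leadingCoeff_add_sum_log_roots
    rw [hz, Multiset.map_map, coeffPoly_leadingCoeff h1,
      Polynomial.logMahlerMeasure_eq_log_MahlerMeasure] at h2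
    have h3 := (coeffPoly N a).mahlerMeasure_le_sum_norm_coeff
    rw [Polynomial.sum_over_range _ (fun _ => norm_zero), coeffPoly_natDegree h1] at h3
    have h4 : ∑ k ∈ Finset.range (N + 1), ‖(coeffPoly N a).coeff k‖
        = ∑ k ∈ Finset.range (N + 1), ‖a k‖ := by
      refine Finset.sum_congr rfl fun k hk => ?_
      rw [coeffPoly_coeff, if_pos (Nat.lt_succ_iff.1 (Finset.mem_range.1 hk))]
    rw [h4] at h3
    have h5 := Real.log_le_log (Polynomial.mahlerMeasure_pos_of_ne_zero hp) h3
    rw [h2] at h5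
    exact h5
  have habs : ∑ i, |Real.log ‖z i‖| = 2 * ∑ i, Real.posLog ‖z i‖ - ∑ i, Real.log ‖z i‖ := by
    rw [Finset.mul_sum, ← Finset.sum_sub_distrib]
    refine Finset.sum_congr rfl fun i _ => ?_
    rw [← Real.half_mul_log_add_log_abs]
    ring
  rw [habs, coeffSize]
  linarith

/-- Each point outside the annulus contributes more than `-log (1 - ρ)` to `∑ |log ‖z i‖|`. -/
theorem card_norm_not_mem_annulus_le {N : ℕ} {z : Fin N → ℂ} (hz0 : ∀ i, z i ≠ 0) {ρ : ℝ}
    (h0 : 0 < ρ) (h1 : ρ < 1) :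
    (-Real.log (1 - ρ)) *
      ((N : ℝ) - Nat.card {i // 1 - ρ ≤ ‖z i‖ ∧ ‖z i‖ ≤ 1 / (1 - ρ)}) ≤ ∑ i, |Real.log ‖z i‖| := by
  classical
  have hδ : 0 < -Real.log (1 - ρ) := neg_pos.2 (Real.log_neg (by linarith) (by linarith))
  have hcard : (N : ℝ) - Nat.card {i // 1 - ρ ≤ ‖z i‖ ∧ ‖z i‖ ≤ 1 / (1 - ρ)}
      = ∑ i, if 1 - ρ ≤ ‖z i‖ ∧ ‖z i‖ ≤ 1 / (1 - ρ) then (0 : ℝ) else 1 := by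
    rw [Nat.card_eq_fintype_card, Fintype.card_subtype, ← Finset.sum_boole, sub_eq_iff_eq_add,
      ← Finset.sum_add_distrib]
    rw [Finset.sum_congr rfl (g := fun _ => (1 : ℝ)) (fun i _ => by split_ifs <;> simp)]
    simp
  rw [hcard, Finset.mul_sum]
  refine Finset.sum_le_sum fun i _ => ?_
  split_ifs with h
  · simp
  · have hzi : 0 < ‖z i‖ := norm_pos_iff.2 (hz0 i)
    rw [mul_one]
    by_cases h2 : 1 - ρ ≤ ‖z i‖
    · have h3 : 1 / (1 - ρ) < ‖z i‖ := not_le.1 fun h3 => h ⟨h2, h3⟩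
      have := Real.log_lt_log (by positivity [sub_pos.2 h1]) h3
      rw [one_div, Real.log_inv] at this
      exact this.le.trans (le_abs_self _)
    · have := Real.log_lt_log hzi (not_le.1 h2)
      exact (neg_le_neg this.le).trans (neg_le_abs _)

/-! ### Power sums of the normalised zeros -/

theorem re_log_one_sub_sum {ι : Type*} [Fintype ι] {w : ι → ℂ} {x : ℂ}
    (hne : ∀ i, 1 - x * w i ≠ 0) :
    (∑ i, Complex.log (1 - x * w i)).re = Real.log ‖∏ i, (1 - x * w i)‖ := by
  rw [Complex.re_sum, norm_prod, Real.log_prod (fun i _ => norm_ne_zero_iff.2 (hne i))]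
  simp [Complex.log_re]

/-- Power sums are controlled by the maximum of the associated product on the unit circle.
The function `∑ log (1 - x w i)` is holomorphic on the unit disc, vanishes at `0`, and has real
part at most `M` by the maximum principle, so Borel–Carathéodory bounds it by `2 * M` on the circle
of radius `1 / 2`; its `m`-th Taylor coefficient is `-(∑ w i ^ m) / m`. -/
theorem norm_sum_pow_le_of_norm_prod_le {ι : Type*} [Fintype ι] {w : ι → ℂ}
    (hw : ∀ i, ‖w i‖ ≤ 1) {M : ℝ} (hM : 0 < M)
    (h : ∀ x : ℂ, ‖x‖ = 1 → ‖∏ i, (1 - x * w i)‖ ≤ Real.exp M) {m : ℕ} (hm : m ≠ 0) :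
    ‖∑ i, w i ^ m‖ ≤ m * 2 ^ (m + 1) * M := by
  have hlt : ∀ {x : ℂ}, ‖x‖ < 1 → ∀ i, ‖x * w i‖ < 1 := by
    intro x hx i
    rw [norm_mul]
    exact (mul_le_of_le_one_right (norm_nonneg x) (hw i)).trans_lt hx
  have hslit : ∀ {y : ℂ}, ‖y‖ < 1 → 1 - y ∈ Complex.slitPlane := by
    intro y hy
    rw [sub_eq_add_neg]
    exact Complex.mem_slitPlane_of_norm_lt_one (by simpa using hy)
  have hne : ∀ {x : ℂ}, ‖x‖ < 1 → ∀ i, 1 - x * w i ≠ 0 := fun hx i =>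
    Complex.slitPlane_ne_zero (hslit (hlt hx i))
  set f : ℂ → ℂ := fun x => ∑ i, Complex.log (1 - x * w i) with hf
  have hdiff : DifferentiableOn ℂ f (Metric.ball 0 1) := by
    refine DifferentiableOn.fun_sum fun i _ => ?_
    intro x hx
    refine DifferentiableWithinAt.clog (by fun_prop) (hslit (hlt (by simpa using hx) i))
  have hmax : ∀ x : ℂ, ‖x‖ < 1 → ‖∏ i, (1 - x * w i)‖ ≤ Real.exp M := by
    intro x hx
    refine Complex.norm_le_of_forall_mem_frontier_norm_le (f := fun x => ∏ i, (1 - x * w i))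
      (U := Metric.ball 0 1) Metric.isBounded_ball ?_ ?_ (subset_closure (by simpa using hx))
    · exact Differentiable.diffContOnCl (by fun_prop)
    · intro y hy
      rw [frontier_ball _ one_ne_zero] at hy
      exact h y (by simpa using hy)
  have hre : Set.MapsTo f (Metric.ball 0 1) {y | y.re ≤ M} := by
    intro x hx
    have hx' : ‖x‖ < 1 := by simpa using hx
    change (∑ i, Complex.log (1 - x * w i)).re ≤ M
    rw [re_log_one_sub_sum (hne hx')]
    exact (Real.log_le_iff_le_exp (norm_pos_iff.2
      (Finset.prod_ne_zero_iff.2 fun i _ => hne hx' i))).2 (hmax x hx')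
  have hf0 : f 0 = 0 := by simp [hf]
  have hbound : ∀ x ∈ Metric.sphere (0 : ℂ) (1 / 2), ‖f x‖ ≤ 2 * M := by
    intro x hx
    have hx' : ‖x‖ = 1 / 2 := by simpa using hx
    have := Complex.borelCaratheodory_zero hM hdiff hre one_pos (z := x)
      (by rw [mem_ball_zero_iff, hx']; norm_num) hf0
    rw [hx'] at this
    exact this.trans (by norm_num)
  have hcauchy := Complex.norm_iteratedDeriv_le_of_forall_mem_sphere_norm_le (f := f) m
    (by norm_num : (0 : ℝ) < 1 / 2)
    ((hdiff.mono (Metric.closedBall_subset_ball (by norm_num))).diffContOnCl_ball subset_rfl) hbound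
  -- The coefficient at `n = 0` is `0`, by the convention for division by zero.
  have hser : ∀ x : ℂ, ‖x‖ < 1 →
      HasSum (fun n : ℕ => x ^ n • (-(∑ i, w i ^ n) / n : ℂ)) (f x) := by
    intro x hx
    have := hasSum_sum (s := (Finset.univ : Finset ι)) fun i _ =>
      (Complex.hasSum_taylorSeries_neg_log (hlt hx i)).neg
    simp only [neg_neg] at this
    refine this.congr_fun fun n => ?_
    rw [smul_eq_mul, ← Finset.sum_neg_distrib, Finset.sum_div, Finset.mul_sum]
    refine Finset.sum_congr rfl fun i _ => ?_
    rw [mul_pow]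
    ring
  have hps : HasFPowerSeriesAt f
      (FormalMultilinearSeries.ofScalars ℂ (fun n : ℕ => (-(∑ i, w i ^ n) / n : ℂ))) 0 := by
    rw [hasFPowerSeriesAt_iff]
    filter_upwards [Metric.ball_mem_nhds (0 : ℂ) one_pos] with x hx
    simpa [FormalMultilinearSeries.coeff_ofScalars] using hser x (by simpa using hx)
  have hcoeff : iteratedDeriv m f 0 / m.factorial = -(∑ i, w i ^ m) / m := by
    have h2 := hps.analyticAt.hasFPowerSeriesAt.eq_formalMultilinearSeries hps
    have h3 := congrArg (fun p => FormalMultilinearSeries.coeff p m) h2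
    simpa [FormalMultilinearSeries.coeff_ofScalars] using h3
  have hm' : (0 : ℝ) < m := by positivity
  have hfac : (0 : ℝ) < m.factorial := by positivity
  have hnorm := congrArg norm hcoeff
  rw [norm_div, norm_div, norm_neg, Complex.norm_natCast, Complex.norm_natCast] at hnorm
  rw [eq_div_iff hm'.ne'] at hnorm
  rw [← hnorm, pow_succ]
  have : ‖iteratedDeriv m f 0‖ / m.factorial ≤ 2 * M * 2 ^ m := by
    rw [div_le_iff₀ hfac]
    refine hcauchy.trans (le_of_eq ?_)
    rw [one_div, inv_pow, div_inv_eq_mul]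
    ring
  nlinarith

/-- Projecting a zero `r u` radially to `u` on the unit circle: the difference of the two sides
is `(1 - r) ^ 2`. -/
theorem norm_one_sub_mul_conj_sq_le {x u : ℂ} (hx : ‖x‖ = 1) (hu : ‖u‖ = 1) (r : ℝ) :
    r * ‖1 - x * (starRingEnd ℂ) u‖ ^ 2 ≤ ‖x - r * u‖ ^ 2 := by
  have hx2 : x.re ^ 2 + x.im ^ 2 = 1 := by
    have := Complex.sq_norm x
    rw [hx, Complex.normSq_apply] at this
    linarith
  have hu2 : u.re ^ 2 + u.im ^ 2 = 1 := by
    have := Complex.sq_norm u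
    rw [hu, Complex.normSq_apply] at this
    linarith
  have h1 : ‖1 - x * (starRingEnd ℂ) u‖ ^ 2 = 2 - 2 * (x.re * u.re + x.im * u.im) := by
    rw [Complex.sq_norm, Complex.normSq_apply]
    simp
    linear_combination (u.re ^ 2 + u.im ^ 2) * hx2 + hu2
  have h2 : ‖x - r * u‖ ^ 2 = 1 + r ^ 2 - 2 * r * (x.re * u.re + x.im * u.im) := by
    rw [Complex.sq_norm, Complex.normSq_apply]
    simp
    linear_combination hx2 + r ^ 2 * hu2
  rw [h1, h2]
  nlinarith [sq_nonneg (1 - r)]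

/-- Since `‖1 - x * conj u‖ ^ 2 ≤ ‖x - z‖ ^ 2 / ‖z‖` for `u = z / ‖z‖` and `‖x‖ = 1`, the product is
at most `‖P x‖ / √(‖a 0‖ ‖a N‖)` on the unit circle. -/
theorem norm_prod_one_sub_le_exp_coeffSize {N : ℕ} {a : ℕ → ℂ} (h0 : a 0 ≠ 0) (h1 : a N ≠ 0)
    {z : Fin N → ℂ}
    (hev : ∀ x, (coeffPoly N a).eval x = a N * ∏ i, (x - z i))
    {x : ℂ} (hx : ‖x‖ = 1) :
    ‖∏ i, (1 - x * (starRingEnd ℂ) (Complex.exp ((z i).arg * Complex.I)))‖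
      ≤ Real.exp (coeffSize N a) := by
  have hz0 := zeros_ne_zero h0 hev
  have hlog := log_norm_coeff_zero h0 h1 hev
  set u : Fin N → ℂ := fun i => Complex.exp ((z i).arg * Complex.I) with hu
  have hu1 : ∀ i, ‖u i‖ = 1 := fun i => Complex.norm_exp_ofReal_mul_I _
  -- Taking logarithms requires `x` to be none of the points `u i`.
  rcases eq_or_ne (∏ i, (1 - x * (starRingEnd ℂ) (u i))) 0 with hq | hq
  · change ‖∏ i, (1 - x * (starRingEnd ℂ) (u i))‖ ≤ _
    rw [hq, norm_zero]
    exact (Real.exp_pos _).le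
  have hq' : ∀ i, 0 < ‖1 - x * (starRingEnd ℂ) (u i)‖ := fun i =>
    norm_pos_iff.2 (Finset.prod_ne_zero_iff.1 hq i (Finset.mem_univ i))
  rw [← Real.log_le_iff_le_exp (norm_pos_iff.2 hq)]
  have hfac : ∀ i, Real.log ‖z i‖ + 2 * Real.log ‖1 - x * (starRingEnd ℂ) (u i)‖
      ≤ 2 * Real.log ‖x - z i‖ ∧ 0 < ‖x - z i‖ := by
    intro i
    have hz : 0 < ‖z i‖ := norm_pos_iff.2 (hz0 i)
    have h2 := norm_one_sub_mul_conj_sq_le hx (hu1 i) ‖z i‖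
    rw [show (‖z i‖ : ℂ) * u i = z i from Complex.norm_mul_exp_arg_mul_I (z i)] at h2
    have h3 : 0 < ‖z i‖ * ‖1 - x * (starRingEnd ℂ) (u i)‖ ^ 2 := mul_pos hz (pow_pos (hq' i) 2)
    have h4 := Real.log_le_log h3 h2
    rw [Real.log_mul hz.ne' (pow_pos (hq' i) 2).ne', Real.log_pow, Real.log_pow] at h4
    refine ⟨by exact_mod_cast h4, ?_⟩
    exact (norm_nonneg _).lt_of_ne' fun h => by
      rw [h] at h2
      norm_num at h2
      linarith
  have hsum := Finset.sum_le_sum fun i (_ : i ∈ Finset.univ) => (hfac i).1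
  rw [Finset.sum_add_distrib, ← Finset.mul_sum, ← Finset.mul_sum] at hsum
  -- The triangle inequality `‖P x‖ ≤ ∑ ‖a k‖` on the unit circle.
  have hP : Real.log ‖a N‖ + ∑ i, Real.log ‖x - z i‖
      ≤ Real.log (∑ k ∈ Finset.range (N + 1), ‖a k‖) := by
    rw [← Real.log_prod (fun i _ => (hfac i).2.ne'), ← norm_prod,
      ← Real.log_mul (norm_ne_zero_iff.2 h1) (norm_ne_zero_iff.2 (Finset.prod_ne_zero_iff.2
        fun i _ => norm_pos_iff.1 (hfac i).2)), ← norm_mul, ← hev x, coeffPoly_eval]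
    refine Real.log_le_log ?_ ?_
    · rw [← coeffPoly_eval, hev x, norm_mul, norm_prod]
      exact mul_pos (norm_pos_iff.2 h1) (Finset.prod_pos fun i _ => (hfac i).2)
    · refine (norm_sum_le _ _).trans (le_of_eq (Finset.sum_congr rfl fun k _ => ?_))
      rw [norm_mul, norm_pow, hx, one_pow, mul_one]
  rw [norm_prod, Real.log_prod (fun i _ => (hq' i).ne'), coeffSize]
  linarith

theorem norm_sum_fourier_arg_le {N : ℕ} (hN : 1 ≤ N) {a : ℕ → ℂ} (h0 : a 0 ≠ 0) (h1 : a N ≠ 0)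
    {z : Fin N → ℂ} (hev : ∀ x, (coeffPoly N a).eval x = a N * ∏ i, (x - z i)) {n : ℤ} (hn : n ≠ 0) :
    ‖∑ i, fourier n (((z i).arg : ℝ) : AddCircle (2 * Real.pi))‖
      ≤ n.natAbs * 2 ^ (n.natAbs + 1) * coeffSize N a := by
  have hbound := norm_sum_pow_le_of_norm_prod_le
    (w := fun i => (starRingEnd ℂ) (Complex.exp ((z i).arg * Complex.I)))
    (fun i => by rw [RCLike.norm_conj, Complex.norm_exp_ofReal_mul_I])
    (coeffSize_pos hN h0 h1)
    (fun x hx => norm_prod_one_sub_le_exp_coeffSize h0 h1 hev hx)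
    (Int.natAbs_ne_zero.2 hn)
  have hpow : ∀ (m : ℕ) i, fourier (m : ℤ) (((z i).arg : ℝ) : AddCircle (2 * Real.pi))
      = Complex.exp ((z i).arg * Complex.I) ^ m := by
    intro m i
    rw [fourier_coe_apply, ← Complex.exp_nat_mul]
    congr 1
    have : (Real.pi : ℂ) ≠ 0 := by exact_mod_cast Real.pi_ne_zero
    push_cast
    field_simp
  have hconj : ∀ (m : ℕ) i, fourier (-(m : ℤ)) (((z i).arg : ℝ) : AddCircle (2 * Real.pi))
      = (starRingEnd ℂ) (Complex.exp ((z i).arg * Complex.I)) ^ m := by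
    intro m i
    rw [fourier_neg, hpow, map_pow]
  -- The power sums of the conjugates are the coefficients of negative index; conjugating gives
  -- the others.
  rcases Int.natAbs_eq n with h | h
  · rw [h, Finset.sum_congr rfl fun i _ => hpow _ i, ← h, ← RCLike.norm_conj, map_sum]
    simpa only [map_pow] using hbound
  · rw [h, Finset.sum_congr rfl fun i _ => hconj _ i, ← h]
    exact hbound

/-! ### Distribution of the zeros -/

theorem coe_arg_mem_image_Ico_iff {θ φ : ℝ} (hθ : 0 ≤ θ) (hφ : φ ≤ 2 * Real.pi) (z : ℂ) :
    ((z.arg : ℝ) : AddCircle (2 * Real.pi)) ∈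
        ((↑) : ℝ → AddCircle (2 * Real.pi)) '' Set.Ico θ φ ↔
      θ ≤ argTwoPi z ∧ argTwoPi z < φ := by
  have : Fact (0 < 2 * Real.pi) := ⟨Real.two_pi_pos⟩
  have hcoe : ((argTwoPi z : ℝ) : AddCircle (2 * Real.pi)) = ((z.arg : ℝ) : AddCircle _) := by
    rw [argTwoPi, toIcoMod, AddCircle.coe_sub, AddCircle.coe_zsmul, AddCircle.coe_period,
      smul_zero, sub_zero]
  constructor
  · rintro ⟨y, hy, hyz⟩
    rw [← hcoe] at hyz
    have h2 : argTwoPi z ∈ Set.Ico (0 : ℝ) (0 + 2 * Real.pi) := toIcoMod_mem_Ico _ _ _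
    rw [← (AddCircle.coe_eq_coe_iff_of_mem_Ico (p := 2 * Real.pi) (a := 0)
      ⟨hθ.trans hy.1, by linarith [hy.2]⟩ h2).1 hyz]
    exact hy
  · exact fun h => ⟨_, h, hcoe⟩

theorem mainTheorem2 (a : ℕ → ℕ → ℂ)
    (ha : ∀ N : ℕ, 1 ≤ N → a N 0 * a N N ≠ 0)
    (hL : (fun N : ℕ => coeffSize N (a N)) =o[atTop] (fun N : ℕ => (N : ℝ))) :
    (∀ ρ : ℝ, 0 < ρ → ρ < 1 →
      Tendsto (fun N : ℕ => (1 / (N : ℝ)) * (annulusCount (coeffPoly N (a N)) ρ : ℝ))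
        atTop (nhds 1)) ∧
    (∀ θ φ : ℝ, 0 ≤ θ → θ < φ → φ ≤ 2 * Real.pi →
      Tendsto (fun N : ℕ => (1 / (N : ℝ)) * (sectorCount (coeffPoly N (a N)) θ φ : ℝ))
        atTop (nhds ((φ - θ) / (2 * Real.pi)))) := by
  have h0 : ∀ N : ℕ, 1 ≤ N → a N 0 ≠ 0 := fun N hN => left_ne_zero_of_mul (ha N hN)
  have h1 : ∀ N : ℕ, 1 ≤ N → a N N ≠ 0 := fun N hN => right_ne_zero_of_mul (ha N hN)
  choose z hz hev using fun N (hN : 1 ≤ N) => exists_zeros_coeffPoly (h1 N hN)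
  have hlim : Tendsto (fun N : ℕ => coeffSize N (a N) / N) atTop (nhds 0) :=
    hL.tendsto_div_nhds_zero
  refine ⟨fun ρ hρ0 hρ1 => ?_, fun θ φ hθ hθφ hφ => ?_⟩
  · have hδ : 0 < -Real.log (1 - ρ) := neg_pos.2 (Real.log_neg (by linarith) (by linarith))
    have hlow : Tendsto (fun N : ℕ => 1 - 2 / (-Real.log (1 - ρ)) * (coeffSize N (a N) / N))
        atTop (nhds 1) := by
      simpa using (hlim.const_mul (2 / (-Real.log (1 - ρ)))).const_sub 1
    refine tendsto_of_tendsto_of_tendsto_of_le_of_le' hlow tendsto_const_nhds ?_ ?_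
    all_goals
      filter_upwards [eventually_ge_atTop 1] with N hN
      have hN' : (0 : ℝ) < N := by exact_mod_cast hN
      rw [annulusCount, hz N hN, Multiset.countP_map_univ, one_div_mul_eq_div]
    · have h := (card_norm_not_mem_annulus_le (zeros_ne_zero (h0 N hN) (hev N hN)) hρ0 hρ1).trans
        (sum_abs_log_norm_le (h0 N hN) (h1 N hN) (hz N hN) (hev N hN))
      rw [mul_comm, ← le_div_iff₀ hδ] at h
      rw [le_div_iff₀ hN', sub_mul, mul_assoc, div_mul_cancel₀ _ hN'.ne', div_mul_eq_mul_div]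
      linarith
    · rw [div_le_one hN']
      have := Finite.card_subtype_le fun i => 1 - ρ ≤ ‖z N hN i‖ ∧ ‖z N hN i‖ ≤ 1 / (1 - ρ)
      rw [Nat.card_fin] at this
      exact_mod_cast this
  · have : Fact (0 < 2 * Real.pi) := ⟨Real.two_pi_pos⟩
    -- Dropping `N = 0` leaves nonempty sets of zeros, which carry an empirical measure.
    rw [← tendsto_add_atTop_iff_nat 1]
    have hN : ∀ N : ℕ, 1 ≤ N + 1 := fun N => Nat.le_add_left 1 N
    refine (tendsto_card_arc_of_tendsto_sum_fourier
      (fun N i => (((z (N + 1) (hN N) i).arg : ℝ) : AddCircle (2 * Real.pi))) ?_ hθφ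
      (by linarith)).congr fun N => ?_
    · intro n hn
      have hlim' := ((tendsto_add_atTop_iff_nat 1).2 hlim).const_mul
        ((n.natAbs : ℝ) * 2 ^ (n.natAbs + 1))
      rw [mul_zero] at hlim'
      refine squeeze_zero_norm (fun N => ?_) hlim'
      have hb := norm_sum_fourier_arg_le (hN N) (h0 _ (hN N)) (h1 _ (hN N)) (hev _ (hN N)) hn
      rw [norm_mul, norm_div, norm_one, Complex.norm_natCast, one_div_mul_eq_div, ← mul_div_assoc]
      gcongr
    · rw [sectorCount, hz _ (hN N), Multiset.countP_map_univ]
      simp only [coe_arg_mem_image_Ico_iff hθ hφ]
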